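/- The game of Cat Herding is played on a (possibly infinite) simple graph $G$ as follows. The cat first chooses a vertex of $G$ as its position. Then, alternately, the herder deletes one edge of the current graph, and the cat moves along a non-trivial finite path of the resulting graph to a new vertex. The cat is captured as soon as it is on a vertex of degree $0$ in the current graph. The graph $G$ is called cat-win if the cat has a strategy (including the choice of the starting vertex) by which it is never captured, whatever the herder does. The infinite complete binary tree $B^{\omega}$ is the graph whose vertices are the finite words over the alphabet $\{L,R\}$ (including the empty word), with an edge between $\alpha$ and $\alpha t$ for each word $\alpha$ and each $t\in\{L,R\}$. A graph $G$ contains a $B^{\omega}$ minor if there is a family $(B_\alpha)$ of pairwise disjoint, non-empty sets of vertices of $G$, indexed by the vertices $\alpha$ of $B^{\omega}$, such that each $B_\alpha$ induces a connected subgraph of $G$ and, for each edge $\alpha\beta$ of $B^{\omega}$, some edge of $G$ joins a vertex of $B_\alpha$ to a vertex of $B_\beta$. **Theorem.** A tree $T$ (finite or infinite, of any cardinality) is cat-win if and only if $T$ contains a $B^{\omega}$ minor. -/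

import Mathlib

namespace CatHerding

/-- The graph that remains after the edges in the list `l` have been deleted from `G`. -/
def afterCuts {V : Type*} (G : SimpleGraph V) (l : List (Sym2 V)) : SimpleGraph V :=
  G.deleteEdges {e | e ∈ l}

/-- The finite sequences of cuts that the herder can play on `G`, listed with the most recent cut
first: each cut deletes an edge of the graph that is present at that moment. -/
inductive LegalCuts {V : Type*} (G : SimpleGraph V) : List (Sym2 V) → Prop
  | nil : LegalCuts G []
  | cons {e : Sym2 V} {l : List (Sym2 V)} :
      LegalCuts G l → e ∈ (afterCuts G l).edgeSet → LegalCuts G (e :: l)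

/-- A cat move in the current graph `H` from `u` to `w`: along a non-trivial (finite) path. -/
def CatMove {V : Type*} (H : SimpleGraph V) (u w : V) : Prop :=
  ∃ p : H.Walk u w, p.IsPath ∧ 0 < p.length

/-- The cat on `v` is captured in the current graph `H` if `v` is isolated in `H`. -/
def Captured {V : Type*} (H : SimpleGraph V) (v : V) : Prop :=
  ∀ w, ¬ H.Adj v w

/-- A strategy of the cat gives the position of the cat after its answer to each finite sequence of
cuts (most recent cut first); its value at `[]` is the vertex on which the cat starts. It is winning
if, whatever the herder cuts, the cat is never captured and always answers the cut by a legal move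
in the graph from which the edge has just been deleted. -/
structure IsWinningStrategy {V : Type*} (G : SimpleGraph V) (σ : List (Sym2 V) → V) : Prop where
  not_captured : ∀ l, LegalCuts G l → ¬ Captured (afterCuts G l) (σ l)
  legal_move : ∀ e l, LegalCuts G (e :: l) → CatMove (afterCuts G (e :: l)) (σ l) (σ (e :: l))

/-- `G` is cat-win: the cat can choose a starting vertex and evade capture forever. -/
def CatWin {V : Type*} (G : SimpleGraph V) : Prop :=
  ∃ σ : List (Sym2 V) → V, IsWinningStrategy G σ

/-- The infinite complete binary tree: its vertices are the finite words over a two-letter alphabet,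
and its edges join `α` to `α t` for each word `α` and each letter `t`. -/
def binaryTree : SimpleGraph (List Bool) where
  Adj α β := (∃ t, β = α ++ [t]) ∨ (∃ t, α = β ++ [t])
  symm := ⟨fun _ _ h => h.symm⟩
  loopless := ⟨fun α h => by rcases h with ⟨t, h⟩ | ⟨t, h⟩ <;> simp at h⟩

/-- `G` contains a minor isomorphic to `H`: there are pairwise disjoint (non-empty) connected sets
of vertices of `G`, one for each vertex of `H`, such that for each edge of `H` there is an edge of
`G` between the two corresponding sets. -/
def HasMinor {V W : Type*} (G : SimpleGraph V) (H : SimpleGraph W) : Prop :=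
  ∃ B : W → Set V,
    (∀ w, (G.induce (B w)).Connected) ∧
    (∀ w w', w ≠ w' → Disjoint (B w) (B w')) ∧
    (∀ w w', H.Adj w w' → ∃ x ∈ B w, ∃ y ∈ B w', G.Adj x y)

end CatHerding

/-!
# Cat Herding on trees

Root the tree. Call a vertex *thin* if it belongs to the least set `Thin` such that `u` is in the
set whenever its descendants outside the set form a chain. The proof splits on whether the root is
thin.

If the root is thin, the herder wins (`Thin.not_confined`), by induction on thinness: suppose that
the cat is confined to the descendants of `u`, and that all descendants of `u` off a chain `C` are
already known to be losing confinements for the cat. When the cat is off `C`, the herder cuts the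
edge above it. When the cat is on `C`, he cuts the edge along which `C` continues downwards, so that
the cat must leave `C` or move strictly upwards along it, and it can do the latter only finitely
often.

If the root is not thin, then every vertex that is not thin has two incomparable descendants that
are not thin, which gives a branching system of vertices and, taking the intervals between them as
branch sets, a binary tree minor (`hasMinor_of_branching`). Hence a cat-win tree has such a minor.

Conversely, a binary tree minor in any graph yields an immersion of the binary tree by pairwise
edge-disjoint walks (`HasMinor.exists_binaryImmersion`): as the binary tree has maximum degree three,
it is enough to join the three attachment vertices of each branch set to one vertex by edge-disjoint
walks (`exists_median`). The cat then walks down the nodes of the immersion: a single cut affects the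
part below at most one of the two children of its node, and it moves to the other child
(`BinaryImmersion.catWin`).
-/

namespace CatHerding

open SimpleGraph

variable {V : Type*}

/-! ### Rooted trees as parent functions -/

/-- `par` is the parent function of the tree `T` rooted at `r`, the root being its own parent, and
`depth` is any function that decreases strictly from a vertex to its parent. -/
structure IsRooting (T : SimpleGraph V) (r : V) (par : V → V) (depth : V → ℕ) : Prop where
  adj_iff : ∀ u v, T.Adj u v ↔ u ≠ v ∧ (par u = v ∨ par v = u)
  depth_lt : ∀ v, par v ≠ v → depth (par v) < depth v
  exists_iterate : ∀ x, ∃ n, par^[n] x = r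

theorem exists_isRooting {T : SimpleGraph V} (hT : T.IsTree) (r : V) :
    ∃ par depth, IsRooting T r par depth := by
  classical
  choose p hp _ using fun v => hT.existsUnique_path v r
  have key : ∀ {u v}, T.Adj u v → (p u).snd = v ∨ (p v).snd = u := by
    intro u v huv
    by_cases hv : v ∈ (p u).support
    · exact .inl (hT.isAcyclic.eq_snd_of_adj_start (hp u) huv hv).symm
    · have := (hT.existsUnique_path v r).unique (hp v) ((hp u).cons hv (h := huv.symm))
      exact .inr (by rw [this]; simp)
  have hnil : ∀ v, (p v).snd ≠ v → ¬ (p v).Nil := by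
    intro v h hn
    apply h
    have h0 := Walk.length_eq_zero_iff.2 hn
    rw [Walk.snd, Walk.getVert_of_length_le _ (by omega)]
    exact hn.eq.symm
  have htail : ∀ v, (h : ¬ (p v).Nil) → (p (p v).snd).length + 1 = (p v).length := by
    intro v h
    rw [(hT.existsUnique_path _ r).unique (hp _) (hp v).tail]
    exact Walk.length_tail_add_one h
  refine ⟨fun v => (p v).snd, fun v => (p v).length, ?_, ?_, ?_⟩
  · refine fun u v => ⟨fun h => ⟨h.ne, key h⟩, ?_⟩
    rintro ⟨hne, rfl | rfl⟩
    · exact (p u).adj_snd (hnil u hne.symm)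
    · exact ((p v).adj_snd (hnil v hne)).symm
  · intro v h
    have := htail v (hnil v h)
    omega
  · intro x
    induction hn : (p x).length generalizing x with
    | zero => exact ⟨0, Walk.eq_of_length_eq_zero hn⟩
    | succ k ih =>
      have hx : ¬ (p x).Nil := by simp [← Walk.length_eq_zero_iff, hn]
      obtain ⟨m, hm⟩ := ih (p x).snd (by have := htail x hx; omega)
      exact ⟨m + 1, by simpa using hm⟩

/-- `x` is a descendant of `u` (possibly `u` itself) for the parent function `par`. -/
def Desc (par : V → V) (u x : V) : Prop := ∃ n, par^[n] x = u

namespace Desc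

variable {par : V → V} {u v x y : V}

theorem refl (par : V → V) (u : V) : Desc par u u := ⟨0, rfl⟩

theorem parent (par : V → V) (u : V) : Desc par (par u) u := ⟨1, rfl⟩

theorem trans (h : Desc par u v) (h' : Desc par v x) : Desc par u x := by
  obtain ⟨n, rfl⟩ := h
  obtain ⟨m, rfl⟩ := h'
  exact ⟨n + m, Function.iterate_add_apply par n m x⟩

theorem of_parent (h : Desc par u (par x)) : Desc par u x := h.trans (parent par x)

/-- A descendant of `u` is `u` itself or has a parent that is a descendant of `u`. -/
theorem eq_or_parent (h : Desc par u x) : x = u ∨ Desc par u (par x) := by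
  obtain ⟨_ | n, rfl⟩ := h
  · exact .inl rfl
  · exact .inr ⟨n, rfl⟩

/-- The ancestors of a vertex form a chain. -/
theorem total (h : Desc par u x) (h' : Desc par v x) : Desc par u v ∨ Desc par v u := by
  obtain ⟨n, rfl⟩ := h
  obtain ⟨m, rfl⟩ := h'
  rcases le_total n m with hnm | hnm
  · exact .inr ⟨m - n, by rw [← Function.iterate_add_apply, Nat.sub_add_cancel hnm]⟩
  · exact .inl ⟨n - m, by rw [← Function.iterate_add_apply, Nat.sub_add_cancel hnm]⟩

/-- A proper descendant of `v` lies below a child of `v`. -/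
theorem exists_child (h : Desc par v x) (hne : x ≠ v) :
    ∃ c, par c = v ∧ c ≠ v ∧ Desc par c x := by
  obtain ⟨n, hn⟩ := h
  induction n generalizing x with
  | zero => exact absurd hn hne
  | succ n ih =>
    by_cases hx : par x = v
    · exact ⟨x, hx, hne, refl par x⟩
    · obtain ⟨c, hc, hcv, hcx⟩ := ih hx hn
      exact ⟨c, hc, hcv, hcx.of_parent⟩

end Desc

namespace IsRooting

variable {T : SimpleGraph V} {r : V} {par : V → V} {depth : V → ℕ}

theorem desc_root (h : IsRooting T r par depth) (x : V) : Desc par r x := h.exists_iterate x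

theorem adj_parent (h : IsRooting T r par depth) {x : V} (hx : par x ≠ x) : T.Adj x (par x) :=
  (h.adj_iff _ _).2 ⟨hx.symm, .inl rfl⟩

theorem depth_lt_of_desc (h : IsRooting T r par depth) {u x : V} (hux : Desc par u x)
    (hne : x ≠ u) : depth u < depth x := by
  obtain ⟨n, hn⟩ := hux
  induction n generalizing x with
  | zero => exact absurd hn hne
  | succ n ih =>
    by_cases hx : par x = x
    · exact absurd ((Function.iterate_fixed hx (n + 1)).symm.trans hn) hne
    · have h1 := h.depth_lt x hx
      by_cases hu : par x = u
      · rwa [hu] at h1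
      · exact (ih hu hn).trans h1

theorem desc_antisymm (h : IsRooting T r par depth) {u x : V} (hux : Desc par u x)
    (hxu : Desc par x u) : u = x := by
  by_contra hne
  have h1 := h.depth_lt_of_desc hux (Ne.symm hne)
  have h2 := h.depth_lt_of_desc hxu hne
  omega

/-- Distinct siblings have no common descendant. -/
theorem eq_of_sibling (h : IsRooting T r par depth) {v c c' x : V} (hc : par c = v) (hcv : c ≠ v)
    (hc' : par c' = v) (hcv' : c' ≠ v) (hx : Desc par c x) (hx' : Desc par c' x) : c = c' := by
  have key : ∀ {a b : V}, par a = v → a ≠ v → par b = v → Desc par a b → b = a := by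
    intro a b ha hav hb hab
    rcases hab.eq_or_parent with h1 | h1
    · exact h1
    · rw [hb] at h1
      exact absurd (h.desc_antisymm h1 ⟨1, ha⟩) hav
  rcases hx.total hx' with h1 | h1
  · exact (key hc hcv hc' h1).symm
  · exact key hc' hcv' hc h1

/-- In a subgraph without the edge above `c`, no walk leaves the set of descendants of `c`. -/
theorem desc_of_reachable (h : IsRooting T r par depth) {H : SimpleGraph V} (hH : H ≤ T) {c : V}
    (hc : ¬ H.Adj c (par c)) {w x : V} (hw : Desc par c w) (hwx : H.Reachable w x) :
    Desc par c x := by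
  obtain ⟨p⟩ := hwx
  induction p with
  | nil => exact hw
  | @cons a b _ hab _ ih =>
    apply ih
    rcases ((h.adj_iff a b).1 (hH hab)).2 with rfl | rfl
    · rcases hw.eq_or_parent with rfl | h1
      · exact absurd hab hc
      · exact h1
    · exact hw.of_parent

end IsRooting

/-! ### Thin vertices and the strategy of the herder -/

/-- The least set of vertices that contains `u` as soon as some chain `C` contains all those
descendants of `u` that are not in the set. Iterating this closure transfinitely would give every
thin vertex an ordinal rank; the inductive predicate replaces that rank. -/
inductive Thin (par : V → V) : V → Prop
  | mk (u : V) (C : Set V) (chain : ∀ x ∈ C, ∀ y ∈ C, Desc par x y ∨ Desc par y x)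
      (thin : ∀ w, Desc par u w → w ∉ C → Thin par w) : Thin par u

theorem afterCuts_le (T : SimpleGraph V) (l : List (Sym2 V)) : afterCuts T l ≤ T :=
  deleteEdges_le _

theorem afterCuts_cons_le (T : SimpleGraph V) (e : Sym2 V) (l : List (Sym2 V)) :
    afterCuts T (e :: l) ≤ afterCuts T l :=
  deleteEdges_anti fun _ h => List.mem_cons_of_mem e h

theorem not_adj_afterCuts_cons (T : SimpleGraph V) (u v : V) (l : List (Sym2 V)) :
    ¬ (afterCuts T (s(u, v) :: l)).Adj u v := by
  simp [afterCuts]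

theorem CatMove.reachable {H : SimpleGraph V} {u w : V} (h : CatMove H u w) : H.Reachable u w :=
  h.elim fun p _ => ⟨p⟩

theorem CatMove.ne {H : SimpleGraph V} {u w : V} (h : CatMove H u w) : w ≠ u := by
  rintro rfl
  obtain ⟨p, hp, h0⟩ := h
  exact h0.ne' (Walk.length_eq_zero_iff.2 (Walk.isPath_iff_nil.1 hp))

/-- The cat cannot win once it is confined to the descendants of a thin vertex `u`. Away from the
chain `C` of `u`, cutting the edge above the cat confines it to the descendants of a vertex for
which the claim holds by induction. On the chain, cutting the edge along which `C` continues
downwards forces the cat to leave `C` or to move strictly upwards on it. -/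
theorem Thin.not_confined {T : SimpleGraph V} {r : V} {par : V → V} {depth : V → ℕ}
    (hR : IsRooting T r par depth) {σ : List (Sym2 V) → V} (hσ : IsWinningStrategy T σ) {u : V}
    (hu : Thin par u) {l : List (Sym2 V)} (hl : LegalCuts T l)
    (hconf : ∀ x, (afterCuts T l).Reachable (σ l) x → Desc par u x) : False := by
  induction hu generalizing l with
  | mk u C chain thin ih =>
  -- If the cat is not on the chain, one cut confines it below a vertex that is not on the chain.
  have off : ∀ l, LegalCuts T l → (∀ x, (afterCuts T l).Reachable (σ l) x → Desc par u x) →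
      σ l ∉ C → False := by
    intro l hl hconf hC
    have hd := hconf _ (Reachable.refl _)
    by_cases hadj : (afterCuts T l).Adj (σ l) (par (σ l))
    · have hl' : LegalCuts T (s(σ l, par (σ l)) :: l) := .cons hl hadj
      refine ih (σ l) hd hC hl' fun x hx => ?_
      exact hR.desc_of_reachable (afterCuts_le _ _) (not_adj_afterCuts_cons _ _ _ _)
        (Desc.refl _ _) ((hσ.legal_move _ _ hl').reachable.trans hx)
    · exact ih (σ l) hd hC hl fun x hx =>
        hR.desc_of_reachable (afterCuts_le _ _) hadj (Desc.refl _ _) hx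
  -- On the chain, the depth of the cat decreases.
  induction hn : depth (σ l) using Nat.strong_induction_on generalizing l with
  | _ n IH =>
  by_cases hC : σ l ∈ C
  swap
  · exact off l hl hconf hC
  -- The herder cuts the edge to the child below which `C` continues, or any edge at the cat if
  -- that edge is already missing.
  obtain ⟨b, hb, hbC⟩ : ∃ b, (afterCuts T l).Adj (σ l) b ∧
      ∀ c, par c = σ l → c ≠ σ l → (∃ d ∈ C, Desc par c d) →
        (afterCuts T l).Adj (σ l) c → c = b := by
    by_cases hc : ∃ c, par c = σ l ∧ c ≠ σ l ∧ (∃ d ∈ C, Desc par c d) ∧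
        (afterCuts T l).Adj (σ l) c
    · obtain ⟨b, hb, hbne, ⟨d, hdC, hbd⟩, hadj⟩ := hc
      refine ⟨b, hadj, fun c hc hcne ⟨d', hdC', hcd'⟩ _ => ?_⟩
      rcases chain d hdC d' hdC' with h1 | h1
      · exact hR.eq_of_sibling hc hcne hb hbne hcd' (hbd.trans h1)
      · exact hR.eq_of_sibling hc hcne hb hbne (hcd'.trans h1) hbd
    · have hcap := hσ.not_captured l hl
      simp only [Captured, not_forall, not_not] at hcap
      obtain ⟨b, hb⟩ := hcap
      exact ⟨b, hb, fun c h1 h2 h3 h4 => absurd ⟨c, h1, h2, h3, h4⟩ hc⟩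
  have hl' : LegalCuts T (s(σ l, b) :: l) := .cons hl hb
  have hmove := hσ.legal_move _ _ hl'
  have hconf' : ∀ x, (afterCuts T (s(σ l, b) :: l)).Reachable (σ (s(σ l, b) :: l)) x →
      Desc par u x := fun x hx =>
    hconf x ((hmove.reachable.trans hx).mono (afterCuts_cons_le _ _ _))
  by_cases hC' : σ (s(σ l, b) :: l) ∈ C
  swap
  · exact off _ hl' hconf' hC'
  rcases chain _ hC' _ hC with h1 | h1
  · exact IH _ (hn ▸ hR.depth_lt_of_desc h1 hmove.ne.symm) hl' hconf' rfl
  · obtain ⟨c, hc, hcne, hcd⟩ := h1.exists_child hmove.ne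
    have hcut : ¬ (afterCuts T (s(σ l, b) :: l)).Adj c (par c) := by
      intro h2
      rw [hc] at h2
      have := hbC c hc hcne ⟨_, hC', hcd⟩ (afterCuts_cons_le _ _ _ h2.symm)
      subst this
      exact not_adj_afterCuts_cons _ _ _ _ h2.symm
    have h3 := hR.desc_of_reachable (afterCuts_le _ _) hcut hcd hmove.reachable.symm
    exact hcne (hR.desc_antisymm h3 ⟨1, hc⟩)

/-! ### Binary tree minors from vertices that are not thin -/

/-- A vertex that is not thin has two incomparable descendants that are not thin: otherwise its
descendants that are not thin would form a chain. -/
theorem exists_children_of_not_thin {par : V → V} {u : V} (hu : ¬ Thin par u) :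
    ∃ g : Bool → V, ∀ t, ¬ Thin par (g t) ∧ Desc par u (g t) ∧ ¬ Desc par (g t) (g !t) := by
  by_contra hg
  refine hu (.mk u {w | Desc par u w ∧ ¬ Thin par w} ?_ fun w hw hw' => ?_)
  · rintro x ⟨hx, hx'⟩ y ⟨hy, hy'⟩
    by_contra hxy
    rw [not_or] at hxy
    refine hg ⟨fun t => cond t x y, ?_⟩
    rintro (_ | _)
    exacts [⟨hy', hy, hxy.2⟩, ⟨hx', hx, hxy.1⟩]
  · by_contra h
    exact hw' ⟨hw, h⟩

/-- Two words are comparable for the suffix order or branch at a common suffix. -/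
theorem suffix_trichotomy (α β : List Bool) :
    α <:+ β ∨ β <:+ α ∨ ∃ γ t, t :: γ <:+ α ∧ (!t) :: γ <:+ β := by
  induction α with
  | nil => exact .inl List.nil_suffix
  | cons a α ih =>
    rcases ih with ⟨δ, rfl⟩ | h | ⟨γ, t, h1, h2⟩
    · rcases δ.eq_nil_or_concat with rfl | ⟨δ, b, rfl⟩
      · exact .inr (.inl (List.suffix_cons a α))
      · rw [List.concat_eq_append]
        have hb : b :: α <:+ δ ++ [b] ++ α := ⟨δ, by simp⟩
        by_cases hab : b = a
        · exact .inl (hab ▸ hb)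
        · obtain rfl : b = !a := by cases a <;> cases b <;> simp_all
          exact .inr (.inr ⟨α, a, List.suffix_rfl, hb⟩)
    · exact .inr (.inl (h.trans (List.suffix_cons a α)))
    · exact .inr (.inr ⟨γ, t, h1.trans (List.suffix_cons a α), h2⟩)

/-- A branching system of vertices gives a binary tree minor: the branch set of a word `α` (read
from right to left) consists of the vertices between `f α` and a vertex `f (t :: α)`, the latter
excluded. -/
theorem hasMinor_of_branching {T : SimpleGraph V} {r : V} {par : V → V} {depth : V → ℕ}
    (hR : IsRooting T r par depth) (f : List Bool → V) (hf : ∀ α t, Desc par (f α) (f (t :: α)))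
    (hinc : ∀ α t, ¬ Desc par (f (t :: α)) (f ((!t) :: α))) : HasMinor T binaryTree := by
  set B : List Bool → Set V := fun α =>
    {w | Desc par (f α) w ∧ ∃ t, Desc par w (f (t :: α)) ∧ w ≠ f (t :: α)} with hB
  have hne : ∀ α t, f (t :: α) ≠ f α := fun α t h => hinc α t (h ▸ hf α !t)
  have hmem : ∀ α, f α ∈ B α := fun α => ⟨Desc.refl _ _, true, hf α true, (hne α true).symm⟩
  have hmono : ∀ {α β}, α <:+ β → Desc par (f α) (f β) := by
    rintro α _ ⟨γ, rfl⟩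
    induction γ with
    | nil => exact Desc.refl _ _
    | cons t γ ih => exact ih.trans (hf _ t)
  have hup : ∀ {α x}, x ∈ B α → x ≠ f α → par x ∈ B α ∧ par x ≠ x := by
    rintro α x ⟨h1, t, h2, h3⟩ hx
    have h4 := h1.eq_or_parent.resolve_left hx
    refine ⟨⟨h4, t, (Desc.parent par x).trans h2, fun h => h3 ?_⟩, fun h => hx ?_⟩
    · exact hR.desc_antisymm h2 (h ▸ Desc.parent par x)
    · obtain ⟨n, hn⟩ := h1
      rw [← hn, Function.iterate_fixed h]
  -- Branch sets on different branches, and branch sets of a word and of a proper extension of it.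
  have hbranch : ∀ {α β γ t}, t :: γ <:+ α → (!t) :: γ <:+ β → ∀ w, Desc par (f α) w →
      Desc par (f β) w → False := by
    intro α β γ t h1 h2 w hα hβ
    rcases ((hmono h1).trans hα).total ((hmono h2).trans hβ) with h | h
    · exact hinc γ t h
    · exact hinc γ (!t) (by simpa using h)
  have hext : ∀ {α β t}, t :: α <:+ β → ∀ w ∈ B α, w ∉ B β := by
    rintro α β t h w ⟨-, s, hs, hs'⟩ ⟨hβ, -⟩
    have hw := (hmono h).trans hβ
    by_cases hst : s = t
    · subst hst
      exact hs' (hR.desc_antisymm hs hw)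
    · obtain rfl : s = !t := by cases s <;> cases t <;> simp_all
      exact hinc α t (hw.trans hs)
  have hdisj : ∀ α β, α ≠ β → ∀ w ∈ B α, w ∉ B β := by
    intro α β hαβ w hα hβ
    have hproper : ∀ {α β : List Bool}, α ≠ β → α <:+ β → ∃ t, t :: α <:+ β := by
      rintro α _ h ⟨δ, rfl⟩
      rcases δ.eq_nil_or_concat with rfl | ⟨δ, b, rfl⟩
      · exact absurd rfl h
      · exact ⟨b, δ, by simp⟩
    rcases suffix_trichotomy α β with h | h | ⟨γ, t, h1, h2⟩
    · obtain ⟨t, ht⟩ := hproper hαβ h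
      exact hext ht w hα hβ
    · obtain ⟨t, ht⟩ := hproper hαβ.symm h
      exact hext ht w hβ hα
    · exact hbranch h1 h2 w hα.1 hβ.1
  have hedge : ∀ α t, ∃ x ∈ B α, ∃ y ∈ B (t :: α), T.Adj x y := by
    intro α t
    have h4 := (hf α t).eq_or_parent.resolve_left (hne α t)
    have h5 : par (f (t :: α)) ≠ f (t :: α) := by
      intro h
      obtain ⟨n, hn⟩ := hf α t
      exact hne α t (by rw [← hn, Function.iterate_fixed h])
    exact ⟨_, ⟨h4, t, Desc.parent _ _, h5⟩, _, hmem _, (hR.adj_parent h5).symm⟩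
  refine ⟨fun w => B w.reverse, fun w => ?_, fun w w' h => ?_, ?_⟩
  · set α := w.reverse
    have hreach : ∀ n x, (hx : x ∈ B α) → par^[n] x = f α →
        (T.induce (B α)).Reachable ⟨x, hx⟩ ⟨f α, hmem α⟩ := by
      intro n
      induction n with
      | zero => rintro x hx rfl; rfl
      | succ n ih =>
        intro x hx hn
        by_cases hxf : x = f α
        · subst hxf; rfl
        · obtain ⟨h1, h2⟩ := hup hx hxf
          refine Reachable.trans (Adj.reachable ?_) (ih (par x) h1 hn)
          exact hR.adj_parent h2
    have hreach' : ∀ x : B α, (T.induce (B α)).Reachable x ⟨f α, hmem α⟩ := fun x =>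
      x.2.1.elim fun n hn => hreach n x x.2 hn
    exact (connected_iff _).2 ⟨fun x y => (hreach' x).trans (hreach' y).symm, ⟨⟨f α, hmem α⟩⟩⟩
  · exact Set.disjoint_left.2 (hdisj _ _ fun h' => h (List.reverse_injective h'))
  · rintro w w' (⟨t, rfl⟩ | ⟨t, rfl⟩)
    · simpa using hedge w.reverse t
    · obtain ⟨x, hx, y, hy, h⟩ := hedge w'.reverse t
      exact ⟨y, by simpa using hy, x, hx, h.symm⟩

theorem hasMinor_of_not_thin {T : SimpleGraph V} {r : V} {par : V → V} {depth : V → ℕ}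
    (hR : IsRooting T r par depth) (hr : ¬ Thin par r) : HasMinor T binaryTree := by
  choose g hg using fun u : {u // ¬ Thin par u} => exists_children_of_not_thin u.2
  let f : List Bool → {u // ¬ Thin par u} := fun α =>
    List.rec ⟨r, hr⟩ (fun t _ u => ⟨g u t, (hg u t).1⟩) α
  exact hasMinor_of_branching hR (fun α => (f α).1) (fun α t => (hg (f α) t).2.1)
    fun α t => (hg (f α) t).2.2

theorem CatWin.hasMinor {T : SimpleGraph V} (hT : T.IsTree) (h : CatWin T) :
    HasMinor T binaryTree := by
  obtain ⟨σ, hσ⟩ := h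
  obtain ⟨par, depth, hR⟩ := exists_isRooting hT (σ [])
  exact hasMinor_of_not_thin hR fun hr =>
    hr.not_confined hR hσ .nil fun x _ => hR.desc_root x

/-! ### Edge-disjoint binary branching and the strategy of the cat -/

/-- From a vertex joined to a walk `q`, some walk leads to `q` without using edges of `q`. -/
theorem exists_walk_to_support {G : SimpleGraph V} {l r : V} (q : G.Walk l r) {p z : V}
    (w : G.Walk p z) (hz : z ∈ q.support) :
    ∃ m ∈ q.support, ∃ a : G.Walk m p, ∀ e ∈ a.edges, e ∉ q.edges := by
  induction w with
  | nil => exact ⟨_, hz, .nil, by simp⟩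
  | @cons u v _ huv w ih =>
    by_cases hu : u ∈ q.support
    · exact ⟨u, hu, .nil, by simp⟩
    · obtain ⟨m, hm, a, ha⟩ := ih hz
      refine ⟨m, hm, a.concat huv.symm, fun e he heq => ?_⟩
      rw [Walk.edges_concat, List.concat_eq_append, List.mem_append, List.mem_singleton] at he
      rcases he with he | rfl
      · exact ha e he heq
      · exact hu (q.snd_mem_support_of_mem_edges heq)

/-- Three vertices of a connected graph are joined to some vertex by pairwise edge-disjoint
walks. -/
theorem exists_median {G : SimpleGraph V} {p l r : V} (hpl : G.Reachable p l)
    (hlr : G.Reachable l r) :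
    ∃ m, ∃ a : G.Walk m p, ∃ b : G.Walk m l, ∃ c : G.Walk m r,
      (∀ e ∈ a.edges, e ∉ b.edges ∧ e ∉ c.edges) ∧ ∀ e ∈ b.edges, e ∉ c.edges := by
  classical
  obtain ⟨w⟩ := hpl
  obtain ⟨q, hq⟩ := hlr.exists_isPath
  obtain ⟨m, hm, a, ha⟩ := exists_walk_to_support q w q.start_mem_support
  refine ⟨m, a, (q.takeUntil m hm).reverse, q.dropUntil m hm, fun e he => ⟨fun h => ?_, fun h => ?_⟩,
    fun e he h => ?_⟩
  · exact ha e he (q.edges_takeUntil_subset_edges hm (by simpa using h))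
  · exact ha e he (q.edges_dropUntil_subset_edges hm h)
  · exact hq.isTrail.disjoint_edges_takeUntil_dropUntil hm (by simpa using he) h

/-- An immersion of the infinite binary tree in `G`: its nodes are joined along the edges of the
binary tree by pairwise edge-disjoint walks. Words are read from right to left, so the children of
`α` are the words `t :: α`; only adjacent nodes have to be distinct. -/
structure BinaryImmersion (G : SimpleGraph V) where
  node : List Bool → V
  walk : ∀ t α, G.Walk (node α) (node (t :: α))
  node_ne : ∀ t α, node (t :: α) ≠ node α
  disjoint : ∀ t α s β, t :: α ≠ s :: β → ∀ e ∈ (walk t α).edges, e ∉ (walk s β).edges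

theorem HasMinor.exists_binaryImmersion {G : SimpleGraph V} (h : HasMinor G binaryTree) :
    Nonempty (BinaryImmersion G) := by
  obtain ⟨B', hconn', hdisj', hadj'⟩ := h
  obtain ⟨B, hB⟩ : ∃ B : List Bool → Set V, B = fun α => B' α.reverse := ⟨_, rfl⟩
  have hconn : ∀ α, (G.induce (B α)).Connected := fun α => by subst hB; exact hconn' _
  have hdisj : ∀ {α β v}, v ∈ B α → v ∈ B β → α = β := by
    intro α β v hα hβ
    subst hB
    by_contra hne
    exact Set.disjoint_left.1 (hdisj' _ _ fun h => hne (List.reverse_injective h)) hα hβ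
  have hadj : ∀ α t, ∃ x ∈ B α, ∃ y ∈ B (t :: α), G.Adj x y := by
    intro α t
    subst hB
    exact hadj' _ _ (.inl ⟨t, List.reverse_cons⟩)
  choose x hx y hy hxy using hadj
  -- `p α` is the end in `B α` of the edge to the parent branch set; at the root any vertex will do.
  obtain ⟨p, hp, hpy⟩ : ∃ p : List Bool → V, (∀ α, p α ∈ B α) ∧ ∀ α t, p (t :: α) = y α t := by
    refine ⟨fun α => α.casesOn (x [] true) fun t α => y α t, fun α => ?_, fun _ _ => rfl⟩
    cases α
    exacts [hx _ _, hy _ _]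
  let K : List Bool → SimpleGraph V := fun α => (G.induce (B α)).spanningCoe
  have hK : ∀ α, K α ≤ G := fun α => G.spanningCoe_induce_le (B α)
  have hKmem : ∀ {α u v} {w : (K α).Walk u v} {e}, e ∈ w.edges → ∀ z ∈ e, z ∈ B α := by
    intro α u v w e he
    have := w.edges_subset_edgeSet he
    induction e with
    | _ a b =>
      simp only [K, mem_edgeSet, map_adj, comap_adj] at this
      obtain ⟨a', b', -, rfl, rfl⟩ := this
      simp
  have hreach : ∀ {α u v}, u ∈ B α → v ∈ B α → (K α).Reachable u v := by
    intro α u v hu hv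
    exact ((hconn α).preconnected ⟨u, hu⟩ ⟨v, hv⟩).map (Embedding.spanningCoe _).toHom
  choose m a b c hab hbc using fun α =>
    exists_median (hreach (hp α) (hx α false)) (hreach (hx α false) (hx α true))
  have hstart : ∀ {α u v}, (K α).Walk u v → v ∈ B α → u ∈ B α := by
    intro α u v q hv
    cases q with
    | nil => exact hv
    | cons h q => exact hKmem (w := .cons h q) List.mem_cons_self _ (Sym2.mem_mk_left _ _)
  have hm : ∀ α, m α ∈ B α := fun α => hstart (a α) (hp α)
  let d : ∀ t α, (K α).Walk (m α) (x α t) := fun t α => t.casesOn (b α) (c α)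
  have had : ∀ {t α e}, e ∈ (a α).edges → e ∉ (d t α).edges := by
    intro t α e he
    cases t
    exacts [(hab α e he).1, (hab α e he).2]
  have hdd : ∀ {t s α e}, e ∈ (d t α).edges → e ∈ (d s α).edges → t = s := by
    intro t s α e he he'
    cases t <;> cases s <;> first
      | rfl | exact absurd he' (hbc α e he) | exact absurd he (hbc α e he')
  let w : ∀ t α, G.Walk (m α) (m (t :: α)) := fun t α =>
    ((d t α).mapLe (hK α)).append <| .cons (hxy α t) <|
      (((a (t :: α)).mapLe (hK _)).reverse.copy (hpy α t) rfl)
  have hw : ∀ {t α e}, e ∈ (w t α).edges ↔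
      e ∈ (d t α).edges ∨ e = s(x α t, y α t) ∨ e ∈ (a (t :: α)).edges := by
    intro t α e
    simp [w, Walk.mapLe, hpy]
  have hself : ∀ {α : List Bool} {t}, α ≠ t :: α := fun h => by simpa using congrArg List.length h
  have hcross : ∀ {α u v} {q : (K α).Walk u v} {t β}, s(x β t, y β t) ∉ q.edges := by
    intro α u v q t β h
    have h1 := hdisj (hKmem h _ (Sym2.mem_mk_left _ _)) (hx β t)
    have h2 := hdisj (hKmem h _ (Sym2.mem_mk_right _ _)) (hy β t)
    exact hself (h1.symm.trans h2)
  have hsame : ∀ {α β u v u' v'} {q : (K α).Walk u v} {q' : (K β).Walk u' v'} {e},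
      e ∈ q.edges → e ∈ q'.edges → α = β := by
    intro α β u v u' v' q q' e h h'
    induction e with
    | _ z _ => exact hdisj (hKmem h z (Sym2.mem_mk_left _ _)) (hKmem h' z (Sym2.mem_mk_left _ _))
  refine ⟨⟨m, w, fun t α h => hself (hdisj (hm α) (h ▸ hm (t :: α))), ?_⟩⟩
  intro t α s β hne e he he'
  rw [hw] at he he'
  rcases he with he | rfl | he <;> rcases he' with he' | he' | he'
  · obtain rfl := hsame he he'
    exact hne (by rw [hdd he he'])
  · exact hcross (he' ▸ he)
  · obtain rfl := hsame he he'
    exact had he' he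
  · exact hcross he'
  · rcases Sym2.eq_iff.1 he' with ⟨-, h⟩ | ⟨h1, h2⟩
    · exact hne (hdisj (hy α t) (h ▸ hy β s))
    · have h1 := hdisj (hx α t) (h1 ▸ hy β s)
      have h2 := hdisj (hy α t) (h2 ▸ hx β s)
      have := congrArg List.length h1
      have := congrArg List.length h2
      simp only [List.length_cons] at *
      omega
  · exact hcross he'
  · obtain rfl := hsame he he'
    exact had he he'
  · exact hcross (he' ▸ he)
  · exact hne (hsame he he')

theorem CatMove.not_captured {H : SimpleGraph V} {u w : V} (h : CatMove H u w) :
    ¬ Captured H u := by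
  obtain ⟨p, -, hp⟩ := h
  cases p with
  | nil => simp at hp
  | cons hadj _ => exact fun hcap => hcap _ hadj

/-- The cat wins if some predicate on positions (cuts made, vertex of the cat) holds at a start,
excludes capture, and can be maintained by a move after every cut. -/
theorem catWin_of_invariant {G : SimpleGraph V} (P : List (Sym2 V) → V → Prop) {v₀ : V}
    (h₀ : P [] v₀) (hcap : ∀ l v, P l v → ¬ Captured (afterCuts G l) v)
    (hmove : ∀ e l v, P l v → ∃ w, CatMove (afterCuts G (e :: l)) v w ∧ P (e :: l) w) :
    CatWin G := by
  choose next hnext using fun e l (v : {v // P l v}) => hmove e l v v.2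
  let τ : ∀ l, {v // P l v} := fun l =>
    List.rec ⟨v₀, h₀⟩ (fun e l v => ⟨next e l v, (hnext e l v).2⟩) l
  exact ⟨fun l => (τ l).1, fun l _ => hcap l _ (τ l).2, fun e l _ => (hnext e l (τ l)).1⟩

/-- The cat stays on nodes `α` such that no walk of the immersion below `α` has lost an edge. A cut
damages the immersion below at most one of the two children of `α`, and the cat moves to the other
child. -/
theorem BinaryImmersion.catWin {G : SimpleGraph V} (I : BinaryImmersion G) : CatWin G := by
  classical
  have hmove : ∀ {l α t}, (∀ e ∈ (I.walk t α).edges, e ∉ l) →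
      CatMove (afterCuts G l) (I.node α) (I.node (t :: α)) := by
    intro l α t h
    let w := (I.walk t α).toDeleteEdges {e | e ∈ l} h
    refine ⟨w.bypass, w.bypass_isPath, Nat.pos_of_ne_zero fun h0 => ?_⟩
    exact I.node_ne t α (Walk.eq_of_length_eq_zero h0).symm
  refine catWin_of_invariant
    (fun l v => ∃ α, v = I.node α ∧ ∀ t β, α <:+ β → ∀ e ∈ (I.walk t β).edges, e ∉ l)
    (v₀ := I.node []) ⟨[], rfl, by simp⟩ ?_ ?_
  · rintro l _ ⟨α, rfl, h⟩ hcap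
    exact (hmove (h true α List.suffix_rfl)).not_captured hcap
  · rintro e l _ ⟨α, rfl, h⟩
    obtain ⟨t, ht⟩ : ∃ t, ∀ s β, t :: α <:+ s :: β → e ∉ (I.walk s β).edges := by
      by_contra! hcon
      obtain ⟨s, β, hβ, he⟩ := hcon false
      obtain ⟨s', β', hβ', he'⟩ := hcon true
      refine I.disjoint s β s' β' (fun heq => ?_) e he he'
      rw [← heq] at hβ'
      have := List.suffix_of_suffix_length_le hβ hβ' (by simp)
      simpa using this.eq_of_length (by simp)
    have hcons : ∀ s β, t :: α <:+ s :: β → ∀ e' ∈ (I.walk s β).edges, e' ∉ e :: l := by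
      intro s β hβ e' he' hmem
      rcases List.mem_cons.1 hmem with rfl | hmem
      · exact ht s β hβ he'
      · refine h s β ?_ e' he' hmem
        rcases List.suffix_cons_iff.1 hβ with heq | h'
        · exact (List.cons.inj heq).2 ▸ List.suffix_rfl
        · exact (List.suffix_cons t α).trans h'
    exact ⟨_, hmove (hcons t α List.suffix_rfl), t :: α, rfl, fun s β hβ =>
      hcons s β (hβ.trans (List.suffix_cons s β))⟩

end CatHerding

theorem mainTheorem2 {V : Type*} (T : SimpleGraph V) (hT : T.IsTree) :
    CatHerding.CatWin T ↔ CatHerding.HasMinor T CatHerding.binaryTree :=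
  ⟨fun h => h.hasMinor hT, fun h => h.exists_binaryImmersion.elim fun I => I.catWin⟩
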